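/- Setting. Let $S\subset[n]$ be a set of $s=|S|\ge 2$ seeds. Let $A$ be a simple graph on $[n]$ (with $0/1$ adjacency matrix $A$), let $Y_{ij}\in\mathbb R^{d_1}$ be edge covariates and $Z_i\in\mathbb R^{d_2}$ node covariates, and let $h_1,\dots,h_{d_2}:\mathbb R^2\to\mathbb R$ be known functions. Put $d=d_1+d_2+2$, $X_{ii}=0$ and, for $i\neq j$, $$X_{ij}=\bigl(1,\;A_{ij},\;Y_{ij},\;(h_k(Z_i^{(k)},Z_j^{(k)}))_{k\le d_2}\bigr)\in\mathbb R^d,\qquad X_{ij}=X_{ji}.$$ Let $\mu:\mathbb R\to\mathbb R$ be an inverse link function, $\psi$ a function with $\psi'=\mu$, and $\theta^*\in\mathbb R^d$. Put $P_{ii}=0$ and $P_{ij}=\mu(X_{ij}^\top\theta^*)$ for $i\ne j$. Conditionally on $A,Y,Z$, let $B$ be a random simple graph on $[n]$ with independent edges $B_{ij}\sim\mathrm{Ber}(P_{ij})$, $i>j$. Let $\Pi_n$ be the set of $n\times n$ permutation matrices, let $Q^*\in\Pi_n$ satisfy $Q^*_{S,S}=I_s$, and let $\widetilde B=Q^{*\top}BQ^*$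 be the observed second graph. The estimators are $$\widehat\theta\in\arg\min_{\theta\in\mathbb R^d}\ \sum_{i,j\in S,\,i>j}\bigl\{-\widetilde B_{ij}X_{ij}^\top\theta+\psi(X_{ij}^\top\theta)\bigr\},\qquad \widehat P_{ij}=\mu(X_{ij}^\top\widehat\theta)\ (i\neq j),\quad \widehat P_{ii}=0,$$ $$\widehat Q\in\arg\min_{Q\in\Pi_n,\;Q_{S,S}=I_s}\ \|\widehat P-Q\widetilde BQ^\top\|_F^2 .$$ For $Q\in\Pi_n$ let $\mathcal K_Q=\{i:Q_{ii}=0\}$, $k_Q=|\mathcal K_Q|$, $\mathcal Q_Q=\{(i,j):i>j,\ i\in\mathcal K_Q\text{ or }j\in\mathcal K_Q\}$ and $M_P(Q)=\|P-QPQ^\top\|_F^2$. Let $\rho_s=\frac{2}{s(s-1)}\sum_{i,j\in S,\,i>j}P_{ij}(1-P_{ij})$. Theorem. Let $d_1,d_2\ge0$ be integers, let $C,C_d,m,c_1^*>0$ and let $M_1,M_2\in\mathbb R$. There are constants $c_2^*,c_3,c>0$, depending only on $(d_1,d_2,C,C_d,M_1,M_2,m,c_1^*)$, such that the following holds in the above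 setting, for all $n$, $S$, $A,Y,Z$, $h$, $\mu$, $\psi$, $\theta^*$, $Q^*$ and every real number $L_s$. Assume: 1. every eigenvalue of $\sum_{i,j\in S,\,i>j}\mu'(X_{ij}^\top\theta^*)X_{ij}X_{ij}^\top$ is at least $CL_ss^2$, and $L_s\ge\rho_s$; 2. $\|X_{ij}\|\le C_d$ for all $i>j$; 3. $\mu$ is twice differentiable with $\mu'>0$, $|\mu'|\le M_1$, $|\mu''|\le M_2$ on $\mathbb R$, and $\mu'(t)\ge m$ whenever $|t|\le C_d\|\theta^*\|$; 4. $s^2L_s\ge c_3\log s$; 5. (density) $\sum_{(i,j)\in\mathcal Q_Q}P_{ij}\ge c_1^*\,k_Q\log n$ for every $Q\in\Pi_n$ with $Q_{S,S}=I_s$ and $k_Q\ge2$; 6. (separation) for every $Q\in\Pi_n$ with $Q_{S,S}=I_s$ and $k_Q\ge2$, $$M_P(Q)\ \ge\ c_2^*\max\Bigl\{k_Q\log n,\ \frac{\sqrt{\log s}}{L_s^{1/2}s}\sum_{(i,j)\in\mathcal Q_Q}P_{ij}\Bigr\}.$$ Then, with conditional probability given $A,Y,Z$ at least $1-c\left(\frac1{n^2}+\frac1s\right)$,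 a minimizer $\widehat\theta$ exists and, for every choice of minimizer $\widehat\theta$, the seeded quadratic assignment problem has $Q^*$ as its unique solution. In particular $\mathbb P(\widehat Q=Q^*\mid A,Y,Z)\ge 1-c\left(\frac1{n^2}+\frac1s\right)$. -/

import Mathlib

namespace CovMatch

noncomputable section

/-- Index set of the `d = d₁ + d₂ + 2` regression coefficients:
intercept, network coefficient, edge covariates, node covariates. -/
abbrev CovIdx (d₁ d₂ : ℕ) : Type := Unit ⊕ Unit ⊕ Fin d₁ ⊕ Fin d₂

/-- Coefficient vectors, with the Euclidean norm. -/
abbrev Coef (d₁ d₂ : ℕ) : Type := EuclideanSpace ℝ (CovIdx d₁ d₂)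

open Classical in
/-- The real 0/1 adjacency matrix of a simple graph on `[n]`. -/
def adj {n : ℕ} (G : SimpleGraph (Fin n)) : Matrix (Fin n) (Fin n) ℝ := G.adjMatrix ℝ

/-- The predictors `X i j = (1, A i j, Y i j, h (Z i) (Z j))` for `i ≠ j`, and `X i i = 0`. -/
def predictors {n d₁ d₂ : ℕ} (A : SimpleGraph (Fin n)) (Y : Fin n → Fin n → Fin d₁ → ℝ)
    (Z : Fin n → Fin d₂ → ℝ) (h : Fin d₂ → ℝ → ℝ → ℝ) (i j : Fin n) : Coef d₁ d₂ :=
  if i = j then 0 else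
    WithLp.toLp 2 (Sum.elim (fun _ => 1) (Sum.elim (fun _ => adj A i j)
      (Sum.elim (Y i j) (fun k => h k (Z i k) (Z j k)))))

/-- The matrix with entries `μ(X i jᵀ θ)` off the diagonal and zero diagonal. It is `P` at the
true coefficient vector and the estimate of `P` at the estimated coefficient vector. -/
def probMatrix {n d₁ d₂ : ℕ} (μ : ℝ → ℝ) (X : Fin n → Fin n → Coef d₁ d₂) (θ : Coef d₁ d₂) :
    Matrix (Fin n) (Fin n) ℝ :=
  Matrix.of fun i j => if i = j then 0 else μ (inner ℝ (X i j) θ)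

/-- `B` is a random simple graph on `[n]` whose edges `{i, j}`, `i > j`, are independent
Bernoulli variables with success probabilities `P i j`. -/
structure IsBernoulliGraph {n : ℕ} {Ω : Type*} [MeasurableSpace Ω] (Pr : MeasureTheory.Measure Ω)
    (P : Matrix (Fin n) (Fin n) ℝ) (B : Ω → SimpleGraph (Fin n)) : Prop where
  measurable : ∀ i j, MeasurableSet {ω | (B ω).Adj i j}
  prob : ∀ i j, j < i → Pr.real {ω | (B ω).Adj i j} = P i j
  indep : ProbabilityTheory.iIndepSet (fun e : {e : Fin n × Fin n // e.2 < e.1} =>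
    {ω | (B ω).Adj e.1.1 e.1.2}) Pr

/-- The pairs `(i, j)` of seeds with `i > j`. -/
def seedPairs {n : ℕ} (S : Finset (Fin n)) : Finset (Fin n × Fin n) :=
  (S ×ˢ S).filter fun e => e.2 < e.1

/-- The generalized linear model loss over the seed pairs. -/
def glmLoss {n d₁ d₂ : ℕ} (ψ : ℝ → ℝ) (X : Fin n → Fin n → Coef d₁ d₂) (S : Finset (Fin n))
    (Bt : Matrix (Fin n) (Fin n) ℝ) (θ : Coef d₁ d₂) : ℝ :=
  ∑ e ∈ seedPairs S,
    (-(Bt e.1 e.2 * inner ℝ (X e.1 e.2) θ) + ψ (inner ℝ (X e.1 e.2) θ))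

/-- The set of minimizers of the loss over all coefficient vectors. -/
def glmArgmin {n d₁ d₂ : ℕ} (ψ : ℝ → ℝ) (X : Fin n → Fin n → Coef d₁ d₂) (S : Finset (Fin n))
    (Bt : Matrix (Fin n) (Fin n) ℝ) : Set (Coef d₁ d₂) :=
  {θ | ∀ θ', glmLoss ψ X S Bt θ ≤ glmLoss ψ X S Bt θ'}

/-- The Hessian matrix of the loss at `θ`. -/
def glmHessian {n d₁ d₂ : ℕ} (μ : ℝ → ℝ) (X : Fin n → Fin n → Coef d₁ d₂) (S : Finset (Fin n))
    (θ : Coef d₁ d₂) : Matrix (CovIdx d₁ d₂) (CovIdx d₁ d₂) ℝ :=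
  ∑ e ∈ seedPairs S, deriv μ (inner ℝ (X e.1 e.2) θ) •
    Matrix.vecMulVec (fun a => X e.1 e.2 a) (fun a => X e.1 e.2 a)

/-- The average variance `ρ_s` of the edges between seeds. -/
def seedVariance {n : ℕ} (P : Matrix (Fin n) (Fin n) ℝ) (S : Finset (Fin n)) : ℝ :=
  2 / ((S.card : ℝ) * ((S.card : ℝ) - 1)) * ∑ e ∈ seedPairs S, P e.1 e.2 * (1 - P e.1 e.2)

/-- The set of `n × n` permutation matrices. -/
def permMatrices (n : ℕ) : Set (Matrix (Fin n) (Fin n) ℝ) :=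
  {Q | ∃ σ : Equiv.Perm (Fin n), Q = σ.permMatrix ℝ}

/-- The permutation matrices `Q` with `Q_{S,S}` the identity. -/
def seededPerms {n : ℕ} (S : Finset (Fin n)) : Set (Matrix (Fin n) (Fin n) ℝ) :=
  {Q | Q ∈ permMatrices n ∧
    ∀ i ∈ S, ∀ j ∈ S, Q i j = (1 : Matrix (Fin n) (Fin n) ℝ) i j}

section Frobenius

attribute [local instance] Matrix.frobeniusNormedAddCommGroup

/-- The squared Frobenius norm. -/
def frobSq {n : ℕ} (M : Matrix (Fin n) (Fin n) ℝ) : ℝ := ‖M‖ ^ 2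

/-- `frobSq` is the sum of the squares of the entries. -/
theorem frobSq_eq {n : ℕ} (M : Matrix (Fin n) (Fin n) ℝ) :
    frobSq M = ∑ i, ∑ j, M i j ^ 2 := by
  have h0 : 0 ≤ ∑ i, ∑ j, M i j ^ 2 :=
    Finset.sum_nonneg fun i _ => Finset.sum_nonneg fun j _ => sq_nonneg _
  unfold frobSq
  rw [Matrix.frobenius_norm_def]
  simp only [Real.rpow_ofNat, Real.norm_eq_abs, sq_abs]
  rw [← Real.sqrt_eq_rpow, Real.sq_sqrt h0]

end Frobenius

/-- The solutions of the seeded quadratic assignment problem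
`min ‖Phat - Q Bt Qᵀ‖_F²` over permutation matrices `Q` with `Q_{S,S} = I`. -/
def qapArgmin {n : ℕ} (S : Finset (Fin n)) (Phat Bt : Matrix (Fin n) (Fin n) ℝ) :
    Set (Matrix (Fin n) (Fin n) ℝ) :=
  {Q | Q ∈ seededPerms S ∧ ∀ Q' ∈ seededPerms S,
    frobSq (Phat - Q * Bt * Q.transpose) ≤ frobSq (Phat - Q' * Bt * Q'.transpose)}

open Classical in
/-- The node labels moved by `Q`; `Q` permutes exactly `k` labels if this set has `k` elements. -/
def movedNodes {n : ℕ} (Q : Matrix (Fin n) (Fin n) ℝ) : Finset (Fin n) :=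
  Finset.univ.filter fun i => Q i i = 0

open Classical in
/-- The pairs `(i, j)`, `i > j`, with at least one label moved by `Q`. -/
def movedPairs {n : ℕ} (Q : Matrix (Fin n) (Fin n) ℝ) : Finset (Fin n × Fin n) :=
  Finset.univ.filter fun e => (e.1 ∈ movedNodes Q ∨ e.2 ∈ movedNodes Q) ∧ e.2 < e.1

/-- `M_P(Q) = ‖P - Q P Qᵀ‖_F²`. -/
def separation {n : ℕ} (P Q : Matrix (Fin n) (Fin n) ℝ) : ℝ :=
  frobSq (P - Q * P * Q.transpose)

end

end CovMatch

/-! A deterministic comparison is combined with three tail bounds. After relabelling by `Qstar`, a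
competitor is a permutation τ ≠ 1 fixing the seeds. With M the separation of τ, expanding squares
shows that the objective at τ exceeds the one at the identity by twice M/2 + ⟨P̂ − P, B − B∘τ⟩ −
⟨P∘τ⁻¹ − P, B − P⟩, so the identity wins once the last two terms are small fractions of M
(`frobSq_lt_of_noise`).

The last term is a sum of independent centred variables with total variance at most a multiple of M;
a Bernstein bound gives probability exp(-M/32) (`IsBernoulliGraph.noise_tail`). The middle term is
at most 4 sup|P̂ − P| times the number of edges of B at moved labels, which is compared with its
mean (`IsBernoulliGraph.count_tail`).

The sup error is Lipschitz in θ̂ − θ*. With high probability every score coordinate is O(s√(L log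
s)), while the curvature is at least C L s². Hence the convex loss is larger on a sphere of radius
of order √(log s)/(√L s) about θ* than at θ*, and all minimizers lie inside it (`glmArgmin_near`).

Permutations moving k labels fail with probability at most n^(-4k), which beats their number
(`sum_perm_ne_one_exp_le`). -/

namespace CovMatch

open MeasureTheory ProbabilityTheory

/-! ### Exponential tail bounds for weighted edge sums -/

/-- The inequality exp x ≤ 1 + x + x² on |x| ≤ 1 turns the exponential moment into mean zero plus
variance. The parameter is fixed at 1, so in later Chernoff bounds the tuning sits in the weight
`a`. -/
theorem mgf_centered_indicator_le {Ω : Type*} [MeasurableSpace Ω] {Pr : Measure Ω}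
    [IsProbabilityMeasure Pr] {s : Set Ω} (hs : MeasurableSet s) {a : ℝ} (ha : |a| ≤ 1) :
    mgf (fun ω => a * (s.indicator (fun _ => (1 : ℝ)) ω - Pr.real s)) Pr 1 ≤
      Real.exp (a ^ 2 * (Pr.real s * (1 - Pr.real s))) := by
  set p := Pr.real s with hp
  have hp0 : 0 ≤ p := measureReal_nonneg
  have hp1 : p ≤ 1 := measureReal_le_one
  have hint : Integrable (s.indicator (fun _ => (1 : ℝ))) Pr :=
    (integrable_const (1 : ℝ)).indicator hs
  have hval : ∫ ω, s.indicator (fun _ => (1 : ℝ)) ω ∂Pr = p := by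
    rw [integral_indicator hs]; simp [hp]
  have h01 := Set.indicator_eq_zero_or_self s (fun _ => (1 : ℝ))
  calc mgf (fun ω => a * (s.indicator (fun _ => (1 : ℝ)) ω - p)) Pr 1
      -- This is 1 + x + x² at x = a(I − p), made affine in the indicator I by I² = I.
      ≤ ∫ ω, ((1 - a * p + a ^ 2 * p ^ 2) +
          (a + a ^ 2 * (1 - 2 * p)) * s.indicator (fun _ => (1 : ℝ)) ω) ∂Pr := by
        refine integral_mono_of_nonneg (Filter.Eventually.of_forall fun ω => (Real.exp_pos _).le)
          ((integrable_const _).add (hint.const_mul _)) (Filter.Eventually.of_forall fun ω => ?_)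
        have key : ∀ x : ℝ, |x| ≤ 1 → Real.exp x ≤ 1 + x + x ^ 2 := fun x hx => by
          have := (abs_le.1 (Real.abs_exp_sub_one_sub_id_le hx)).2
          linarith
        have hx : |1 * (a * (s.indicator (fun _ => (1 : ℝ)) ω - p))| ≤ 1 := by
          rw [one_mul, abs_mul]
          have : |s.indicator (fun _ => (1 : ℝ)) ω - p| ≤ 1 := by
            rcases h01 ω with h | h <;> rw [h, abs_le] <;> constructor <;> linarith
          exact mul_le_one₀ ha (abs_nonneg _) this
        refine (key _ hx).trans (le_of_eq ?_)
        rcases h01 ω with h | h <;> simp only [h] <;> ring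
    _ = 1 + a ^ 2 * (p * (1 - p)) := by
        rw [integral_add (integrable_const _) (hint.const_mul _), integral_const_mul, hval]
        simp
        ring
    _ ≤ _ := by linarith [Real.add_one_le_exp (a ^ 2 * (p * (1 - p)))]

theorem adj_apply_eq_indicator {n : ℕ} {Ω : Type*} (B : Ω → SimpleGraph (Fin n)) (i j : Fin n)
    (ω : Ω) :
    adj (B ω) i j = {ω | (B ω).Adj i j}.indicator (fun _ => (1 : ℝ)) ω := by
  classical
  simp [adj, Set.indicator_apply, SimpleGraph.adjMatrix_apply]

/-- Bernstein type tail bound for weighted sums of the centered edge indicators. -/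
theorem IsBernoulliGraph.tail {n : ℕ} {Ω : Type*} [MeasurableSpace Ω] {Pr : Measure Ω}
    [IsProbabilityMeasure Pr] {P : Matrix (Fin n) (Fin n) ℝ} {B : Ω → SimpleGraph (Fin n)}
    (hB : IsBernoulliGraph Pr P B) (T : Finset (Fin n × Fin n)) (hT : ∀ e ∈ T, e.2 < e.1)
    (a : Fin n × Fin n → ℝ) (ha : ∀ e ∈ T, |a e| ≤ 1) (u : ℝ) :
    Pr.real {ω | u ≤ ∑ e ∈ T, a e * (adj (B ω) e.1 e.2 - P e.1 e.2)} ≤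
      Real.exp (-u + ∑ e ∈ T, a e ^ 2 * (P e.1 e.2 * (1 - P e.1 e.2))) := by
  let N : T → Ω → ℝ := fun e ω => a e *
    ({ω | (B ω).Adj e.1.1 e.1.2}.indicator (fun _ => (1 : ℝ)) ω -
      Pr.real {ω | (B ω).Adj e.1.1 e.1.2})
  have hsum : ∀ ω, ∑ e ∈ T, a e * (adj (B ω) e.1 e.2 - P e.1 e.2) =
      (∑ e ∈ (Finset.univ : Finset T), N e) ω := fun ω => by
    rw [Finset.sum_apply, ← Finset.sum_coe_sort T]
    refine Finset.sum_congr rfl fun e _ => ?_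
    simp only [N]
    rw [adj_apply_eq_indicator, hB.prob _ _ (hT e e.2)]
  have hmeas : ∀ e, Measurable (N e) := fun e =>
    ((measurable_const.indicator (hB.measurable _ _)).sub_const _).const_mul _
  have hind : iIndepFun N Pr := by
    let g : T → {e : Fin n × Fin n // e.2 < e.1} := fun e => ⟨e.1, hT e e.2⟩
    have hg : Function.Injective g := fun x y hxy => Subtype.ext (congrArg (fun z => z.1) hxy)
    have h1 := (hB.indep.iIndepFun_indicator (β := ℝ) (m := inferInstance)).precomp hg
    exact h1.comp (fun e x => a e * (x - Pr.real {ω | (B ω).Adj e.1.1 e.1.2}))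
      (fun e => (measurable_id.sub_const _).const_mul _)
  have hbdd : ∀ ω e, |N e ω| ≤ |a e| := fun ω e => by
    simp only [N, abs_mul]
    have h0 : 0 ≤ Pr.real {ω | (B ω).Adj e.1.1 e.1.2} := measureReal_nonneg
    have h1 : Pr.real {ω | (B ω).Adj e.1.1 e.1.2} ≤ 1 := measureReal_le_one
    refine mul_le_of_le_one_right (abs_nonneg _) ?_
    rcases Set.indicator_eq_zero_or_self {ω | (B ω).Adj e.1.1 e.1.2} (fun _ => (1 : ℝ)) ω with h | h <;>
      rw [h, abs_le] <;> constructor <;> linarith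
  have hintg : Integrable (fun ω => Real.exp (1 * (∑ e ∈ (Finset.univ : Finset T), N e) ω)) Pr := by
    refine integrable_exp_mul_of_mem_Icc (a := -∑ e : T, |a e|) (b := ∑ e : T, |a e|)
      (Finset.aemeasurable_sum _ fun e _ => (hmeas e).aemeasurable)
      (Filter.Eventually.of_forall fun ω => ?_)
    rw [Set.mem_Icc, ← abs_le, Finset.sum_apply]
    exact (Finset.abs_sum_le_sum_abs _ _).trans (Finset.sum_le_sum fun e _ => hbdd ω e)
  have hc := measure_ge_le_exp_mul_mgf (μ := Pr) u zero_le_one hintg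
  simp only [hsum]
  refine hc.trans ?_
  rw [Real.exp_add, neg_one_mul, hind.mgf_sum hmeas, Real.exp_sum, ← Finset.prod_coe_sort T]
  refine mul_le_mul_of_nonneg_left ?_ (Real.exp_pos _).le
  refine Finset.prod_le_prod (fun e _ => mgf_nonneg) fun e _ => ?_
  refine (mgf_centered_indicator_le (hB.measurable _ _) (ha e e.2)).trans (le_of_eq ?_)
  rw [hB.prob _ _ (hT e e.2)]

/-! ### Counting permutations by the number of moved letters -/

/-- A generating function bound: permutations of `n` letters weighted by the number of moved
letters are dominated by all self-maps. -/
theorem sum_perm_pow_support_le {n : ℕ} {x : ℝ} (hx : 0 ≤ x) :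
    ∑ σ : Equiv.Perm (Fin n), x ^ σ.support.card ≤ (1 + n * x) ^ n := by
  -- The weight factorises over letters, so the sum over all self-maps is a product of sums.
  have h1 : ∀ σ : Equiv.Perm (Fin n), x ^ σ.support.card =
      ∏ i, (if σ i = i then 1 else x) := fun σ => by
    rw [Finset.prod_ite, Finset.prod_const_one, one_mul, Finset.prod_const]
    rfl
  have h2 : ∏ _i : Fin n, (1 + n * x) ≥ ∏ i : Fin n, ∑ j : Fin n, (if j = i then 1 else x) := by
    refine Finset.prod_le_prod (fun i _ => Finset.sum_nonneg fun j _ => by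
      split_ifs <;> [exact zero_le_one; exact hx]) fun i _ => ?_
    calc ∑ j : Fin n, (if j = i then 1 else x) ≤ ∑ j : Fin n, ((if j = i then 1 else 0) + x) :=
          Finset.sum_le_sum fun j _ => by split_ifs <;> linarith
      _ = 1 + n * x := by simp [Finset.sum_add_distrib]
  rw [Finset.prod_const, Finset.card_univ, Fintype.card_fin] at h2
  refine le_trans ?_ h2
  rw [Finset.prod_univ_sum, Fintype.piFinset_univ]
  simp only [h1]
  have hinj : Function.Injective (fun (σ : Equiv.Perm (Fin n)) (i : Fin n) => σ i) :=
    DFunLike.coe_injective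
  rw [← Finset.sum_image (s := Finset.univ) (g := fun (σ : Equiv.Perm (Fin n)) (i : Fin n) => σ i)
    (f := fun f : Fin n → Fin n => ∏ i, (if f i = i then 1 else x)) hinj.injOn]
  refine Finset.sum_le_sum_of_subset_of_nonneg (Finset.subset_univ _) fun f _ _ =>
    Finset.prod_nonneg fun i _ => ?_
  split_ifs <;> [exact zero_le_one; exact hx]

/-- Take x = n⁻⁴ in the generating function: (1 + n⁻³)ⁿ ≤ exp(n⁻²) ≤ 1 + 2/n², and the identity
accounts for the 1. -/
theorem sum_perm_ne_one_exp_le {n : ℕ} (hn : 2 ≤ n) :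
    ∑ σ ∈ Finset.univ.erase (1 : Equiv.Perm (Fin n)),
      Real.exp (-(4 * (σ.support.card * Real.log n))) ≤ 2 / (n : ℝ) ^ 2 := by
  have hn' : (2 : ℝ) ≤ n := by exact_mod_cast hn
  have hn0 : (0 : ℝ) < n := by linarith
  have he : ∀ k : ℕ, Real.exp (-(4 * (k * Real.log n))) = (((n : ℝ) ^ 4)⁻¹) ^ k := fun k => by
    rw [show -(4 * (k * Real.log n)) = k * (-(4 * Real.log n)) by ring, Real.exp_nat_mul,
      Real.exp_neg, show (4 : ℝ) * Real.log n = (4 : ℕ) * Real.log n by norm_num, Real.exp_nat_mul,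
      Real.exp_log hn0]
  simp only [he]
  have h1 := sum_perm_pow_support_le (n := n) (x := ((n : ℝ) ^ 4)⁻¹) (by positivity)
  rw [← Finset.add_sum_erase _ _ (Finset.mem_univ (1 : Equiv.Perm (Fin n)))] at h1
  simp only [Equiv.Perm.support_one, Finset.card_empty, pow_zero] at h1
  have h2 : (1 + n * ((n : ℝ) ^ 4)⁻¹) ^ n ≤ Real.exp (1 / (n : ℝ) ^ 2) := by
    have : (1 + n * ((n : ℝ) ^ 4)⁻¹) ≤ Real.exp (n * ((n : ℝ) ^ 4)⁻¹) := by
      linarith [Real.add_one_le_exp (n * ((n : ℝ) ^ 4)⁻¹)]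
    refine (pow_le_pow_left₀ (by positivity) this n).trans (le_of_eq ?_)
    rw [← Real.exp_nat_mul]
    congr 1
    field_simp
  have hy : 1 / (n : ℝ) ^ 2 ≤ 1 := by
    rw [div_le_one (by positivity)]
    nlinarith
  have hy0 : 0 ≤ 1 / (n : ℝ) ^ 2 := by positivity
  have h3 := (abs_le.1 (Real.abs_exp_sub_one_sub_id_le (abs_le.2 ⟨by linarith, hy⟩))).2
  have h4 : (1 / (n : ℝ) ^ 2) ^ 2 ≤ 1 / (n : ℝ) ^ 2 := by nlinarith
  have h5 : 2 / (n : ℝ) ^ 2 = 1 / (n : ℝ) ^ 2 + 1 / (n : ℝ) ^ 2 := by ring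
  linarith

/-! ### Quadratic growth and minimizers of convex functions -/

/-- Quadratic lower bound for a convex function whose second derivative is Lipschitz. -/
theorem quadratic_lower_bound {μ ψ : ℝ → ℝ} {M₂ a t : ℝ} (hψ : ∀ t, HasDerivAt ψ (μ t) t)
    (hμ : Differentiable ℝ μ) (hμ' : Differentiable ℝ (deriv μ))
    (hM : ∀ t, |deriv (deriv μ) t| ≤ M₂) (ht : M₂ * |t| ≤ deriv μ a / 2) :
    ψ a + μ a * t + deriv μ a / 4 * t ^ 2 ≤ ψ (a + t) := by
  have hM0 : 0 ≤ M₂ := (abs_nonneg _).trans (hM 0)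
  -- Over the whole range |y| ≤ |t| the second derivative of ψ keeps half its value at `a`;
  -- integrating twice gives the coefficient 1/4.
  have hlow : ∀ y, |y| ≤ |t| → deriv μ a / 2 ≤ deriv μ (a + y) := fun y hy => by
    have h1 : ‖deriv μ (a + y) - deriv μ a‖ ≤ M₂ * ‖(a + y) - a‖ :=
      Convex.norm_image_sub_le_of_norm_deriv_le (s := Set.univ) (fun x _ => hμ' x)
        (fun x _ => by simpa using hM x) convex_univ trivial trivial
    rw [add_sub_cancel_left, Real.norm_eq_abs, Real.norm_eq_abs] at h1
    have h2 := mul_le_mul_of_nonneg_left hy hM0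
    linarith [(abs_le.1 h1).1]
  have hk : ∀ y, HasDerivAt (fun y => μ (a + y) - μ a - deriv μ a / 2 * y)
      (deriv μ (a + y) - deriv μ a / 2) y := fun y => by
    have h1 : HasDerivAt (fun y => μ (a + y)) (deriv μ (a + y)) y :=
      (hμ (a + y)).hasDerivAt.comp_const_add a y
    refine ((h1.sub_const (μ a)).sub ((hasDerivAt_id y).const_mul (deriv μ a / 2))).congr_deriv ?_
    rw [mul_one]
  have hkmono : MonotoneOn (fun y => μ (a + y) - μ a - deriv μ a / 2 * y)
      (Set.Icc (-|t|) |t|) := by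
    refine monotoneOn_of_deriv_nonneg (convex_Icc _ _)
      (fun y _ => (hk y).continuousAt.continuousWithinAt)
      (fun y _ => (hk y).differentiableAt.differentiableWithinAt) fun y hy => ?_
    rw [(hk y).deriv]
    have hy' : y ∈ Set.Icc (-|t|) |t| := interior_subset hy
    linarith [hlow y (abs_le.2 hy')]
  have h0mem : (0 : ℝ) ∈ Set.Icc (-|t|) |t| := by simp
  have hg : ∀ y, HasDerivAt (fun y => ψ (a + y) - ψ a - μ a * y - deriv μ a / 4 * y ^ 2)
      (μ (a + y) - μ a - deriv μ a / 2 * y) y := fun y => by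
    have h1 : HasDerivAt (fun y => ψ (a + y)) (μ (a + y)) y :=
      (hψ (a + y)).comp_const_add a y
    have h2 := ((h1.sub_const (ψ a)).sub ((hasDerivAt_id y).const_mul (μ a))).sub
      ((hasDerivAt_pow 2 y).const_mul (deriv μ a / 4))
    refine h2.congr_deriv ?_
    simp
    ring
  suffices h : (0 : ℝ) ≤ ψ (a + t) - ψ a - μ a * t - deriv μ a / 4 * t ^ 2 by linarith
  rcases le_total 0 t with h | h
  · have hm : MonotoneOn (fun y => ψ (a + y) - ψ a - μ a * y - deriv μ a / 4 * y ^ 2)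
        (Set.Icc 0 t) := by
      refine monotoneOn_of_deriv_nonneg (convex_Icc _ _)
        (fun y _ => (hg y).continuousAt.continuousWithinAt)
        (fun y _ => (hg y).differentiableAt.differentiableWithinAt) fun y hy => ?_
      have hy' := interior_subset hy
      rw [(hg y).deriv]
      have := hkmono h0mem (show y ∈ Set.Icc (-|t|) |t| by
        rw [abs_of_nonneg h]; exact ⟨by linarith [hy'.1], hy'.2⟩) hy'.1
      simpa using this
    simpa using hm (Set.left_mem_Icc.2 h) (Set.right_mem_Icc.2 h) h
  · have hm : AntitoneOn (fun y => ψ (a + y) - ψ a - μ a * y - deriv μ a / 4 * y ^ 2)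
        (Set.Icc t 0) := by
      refine antitoneOn_of_deriv_nonpos (convex_Icc _ _)
        (fun y _ => (hg y).continuousAt.continuousWithinAt)
        (fun y _ => (hg y).differentiableAt.differentiableWithinAt) fun y hy => ?_
      have hy' := interior_subset hy
      rw [(hg y).deriv]
      have := hkmono (show y ∈ Set.Icc (-|t|) |t| by
        rw [abs_of_nonpos h]; exact ⟨by linarith [hy'.1], by linarith [hy'.2]⟩) h0mem hy'.2
      simpa using this
    simpa using hm (Set.left_mem_Icc.2 h) (Set.right_mem_Icc.2 h) h

/-- A convex continuous function that is larger on a sphere than at its centre has minimizers,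
and all of them lie in the ball. -/
theorem exists_min_of_sphere {E : Type*} [NormedAddCommGroup E] [NormedSpace ℝ E] [ProperSpace E]
    {f : E → ℝ} (hf : ConvexOn ℝ Set.univ f) (hc : Continuous f) {x₀ : E} {r : ℝ} (hr : 0 < r)
    (hs : ∀ v, ‖v‖ = r → f x₀ < f (x₀ + v)) :
    {x | ∀ y, f x ≤ f y}.Nonempty ∧ ∀ x ∈ {x | ∀ y, f x ≤ f y}, ‖x - x₀‖ ≤ r := by
  have hout : ∀ x, r < ‖x - x₀‖ → f x₀ < f x := fun x hx => by
    have hpos : 0 < ‖x - x₀‖ := hr.trans hx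
    set l := r / ‖x - x₀‖ with hl
    have hl0 : 0 < l := div_pos hr hpos
    have hl1 : l < 1 := (div_lt_one hpos).2 hx
    -- The segment from x₀ to x crosses the sphere; convexity carries the strict increase there out
    -- to x.
    have h1 := hs (l • (x - x₀)) (by
      rw [norm_smul, Real.norm_of_nonneg hl0.le, hl, div_mul_cancel₀ _ hpos.ne'])
    have h2 := hf.2 (Set.mem_univ x₀) (Set.mem_univ x) (sub_nonneg.2 hl1.le) hl0.le
      (sub_add_cancel 1 l)
    rw [show (1 - l) • x₀ + l • x = x₀ + l • (x - x₀) by module, smul_eq_mul, smul_eq_mul] at h2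
    nlinarith
  refine ⟨?_, fun x hx => not_lt.1 fun h => absurd (hx x₀) (not_le.2 (hout x h))⟩
  obtain ⟨z, -, hz⟩ := (isCompact_closedBall x₀ r).exists_isMinOn
    ⟨x₀, Metric.mem_closedBall_self hr.le⟩ hc.continuousOn
  refine ⟨z, fun y => ?_⟩
  by_cases hy : y ∈ Metric.closedBall x₀ r
  · exact hz hy
  · rw [mem_closedBall_iff_norm, not_le] at hy
    exact (hz (Metric.mem_closedBall_self hr.le)).trans (hout y hy).le

/-! ### Consistency of the regression estimator -/

section GLM

variable {n d₁ d₂ : ℕ} {μ ψ : ℝ → ℝ} {X : Fin n → Fin n → Coef d₁ d₂} {S : Finset (Fin n)}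
  {Bt : Matrix (Fin n) (Fin n) ℝ}

theorem glmLoss_continuous (hψ : ∀ t, HasDerivAt ψ (μ t) t) : Continuous (glmLoss ψ X S Bt) := by
  have h : Continuous ψ := continuous_iff_continuousAt.2 fun t => (hψ t).continuousAt
  unfold glmLoss
  fun_prop

theorem glmLoss_convexOn (hψ : ∀ t, HasDerivAt ψ (μ t) t) (hμ : Monotone μ) :
    ConvexOn ℝ Set.univ (glmLoss ψ X S Bt) := by
  have hd : deriv ψ = μ := funext fun t => (hψ t).deriv
  have hconv : ConvexOn ℝ Set.univ ψ :=
    Monotone.convexOn_univ_of_deriv (fun t => (hψ t).differentiableAt) (hd ▸ hμ)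
  refine ⟨convex_univ, fun x _ y _ a b ha hb hab => ?_⟩
  simp only [glmLoss, smul_eq_mul, Finset.mul_sum, ← Finset.sum_add_distrib]
  refine Finset.sum_le_sum fun e _ => ?_
  have := hconv.2 (Set.mem_univ (inner ℝ (X e.1 e.2) x)) (Set.mem_univ (inner ℝ (X e.1 e.2) y))
    ha hb hab
  simp only [smul_eq_mul] at this
  rw [inner_add_right, inner_smul_right, inner_smul_right]
  linarith

theorem glmLoss_lower_bound {M₂ Cd m : ℝ} {θ v : Coef d₁ d₂}
    (hψ : ∀ t, HasDerivAt ψ (μ t) t) (hμ : Differentiable ℝ μ) (hμ' : Differentiable ℝ (deriv μ))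
    (hM : ∀ t, |deriv (deriv μ) t| ≤ M₂) (hX : ∀ e ∈ seedPairs S, ‖X e.1 e.2‖ ≤ Cd)
    (hm : ∀ e ∈ seedPairs S, m ≤ deriv μ (inner ℝ (X e.1 e.2) θ))
    (hv : M₂ * (Cd * ‖v‖) ≤ m / 2) :
    glmLoss ψ X S Bt θ
        - ∑ e ∈ seedPairs S, (Bt e.1 e.2 - μ (inner ℝ (X e.1 e.2) θ)) * inner ℝ (X e.1 e.2) v
        + (∑ e ∈ seedPairs S, deriv μ (inner ℝ (X e.1 e.2) θ) * inner ℝ (X e.1 e.2) v ^ 2) / 4 ≤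
      glmLoss ψ X S Bt (θ + v) := by
  have hM0 : 0 ≤ M₂ := (abs_nonneg _).trans (hM 0)
  simp only [glmLoss, Finset.sum_div, ← Finset.sum_sub_distrib, ← Finset.sum_add_distrib]
  refine Finset.sum_le_sum fun e he => ?_
  have h1 : |inner ℝ (X e.1 e.2) v| ≤ Cd * ‖v‖ := (abs_real_inner_le_norm _ _).trans
    (mul_le_mul_of_nonneg_right (hX e he) (norm_nonneg _))
  have h2 := quadratic_lower_bound (a := inner ℝ (X e.1 e.2) θ) (t := inner ℝ (X e.1 e.2) v)
    hψ hμ hμ' hM (by linarith [mul_le_mul_of_nonneg_left h1 hM0, hm e he])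
  rw [inner_add_right]
  linarith

theorem inner_coef (x v : Coef d₁ d₂) : inner ℝ x v = ∑ a, x a * v a := by
  rw [PiLp.inner_apply]
  exact Finset.sum_congr rfl fun a _ => by simp [mul_comm]

/-- A lower bound on the spectrum of the Hessian bounds its quadratic form. -/
theorem glmHessian_lower_bound {κ : ℝ} {θ v : Coef d₁ d₂}
    (h : ∀ l ∈ spectrum ℝ (glmHessian μ X S θ), κ ≤ l) :
    κ * ‖v‖ ^ 2 ≤
      ∑ e ∈ seedPairs S, deriv μ (inner ℝ (X e.1 e.2) θ) * inner ℝ (X e.1 e.2) v ^ 2 := by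
  classical
  have hH : (glmHessian μ X S θ).IsHermitian := by
    ext a b
    simp only [glmHessian, Matrix.conjTranspose_apply, Matrix.sum_apply, Matrix.smul_apply,
      Matrix.vecMulVec_apply, star_trivial, mul_comm (X _ _ b)]
  have hpsd : (glmHessian μ X S θ - algebraMap ℝ _ κ).PosSemidef := by
    rw [Matrix.posSemidef_iff_isHermitian_and_spectrum_nonneg]
    refine ⟨hH.sub ?_, fun l hl => ?_⟩
    · rw [Matrix.algebraMap_eq_diagonal]
      exact Matrix.isHermitian_diagonal _
    · rw [← spectrum.sub_singleton_eq] at hl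
      obtain ⟨l', hl', k, rfl, rfl⟩ := hl
      exact sub_nonneg.2 (h l' hl')
  have h0 := hpsd.dotProduct_mulVec_nonneg (fun a => v a)
  have h1 : star (fun a => v a) ⬝ᵥ (glmHessian μ X S θ - algebraMap ℝ _ κ).mulVec (fun a => v a) =
      ∑ e ∈ seedPairs S, deriv μ (inner ℝ (X e.1 e.2) θ) * inner ℝ (X e.1 e.2) v ^ 2
        - κ * ‖v‖ ^ 2 := by
    rw [Matrix.sub_mulVec, dotProduct_sub, star_trivial]
    congr 1
    · rw [glmHessian, Matrix.sum_mulVec, dotProduct_sum]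
      refine Finset.sum_congr rfl fun e _ => ?_
      rw [Matrix.smul_mulVec, dotProduct_smul, smul_eq_mul, Matrix.vecMulVec_mulVec, dotProduct_smul,
        op_smul_eq_smul, smul_eq_mul, dotProduct_comm (fun a => v a), inner_coef (X e.1 e.2) v, sq]
      rfl
    · rw [Algebra.algebraMap_eq_smul_one, Matrix.smul_mulVec, Matrix.one_mulVec, dotProduct_smul,
        smul_eq_mul, EuclideanSpace.real_norm_sq_eq]
      simp [dotProduct, sq]
  linarith

/-- Controlling the score in the d coordinate directions controls it in all directions, at the price
of a factor d; the random part then needs a union bound over d events only. -/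
theorem abs_score_le {w : Fin n × Fin n → ℝ} {T : Finset (Fin n × Fin n)} {u : ℝ}
    (hu : ∀ a, |∑ e ∈ T, w e * X e.1 e.2 a| ≤ u) (v : Coef d₁ d₂) :
    |∑ e ∈ T, w e * inner ℝ (X e.1 e.2) v| ≤ (d₁ + d₂ + 2 : ℕ) * u * ‖v‖ := by
  have h1 : ∑ e ∈ T, w e * inner ℝ (X e.1 e.2) v = ∑ a, (∑ e ∈ T, w e * X e.1 e.2 a) * v a := by
    simp only [inner_coef, Finset.mul_sum, Finset.sum_mul]
    rw [Finset.sum_comm]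
    simp only [mul_assoc]
  rw [h1]
  refine (Finset.abs_sum_le_sum_abs _ _).trans ?_
  calc ∑ a, |(∑ e ∈ T, w e * X e.1 e.2 a) * v a| ≤ ∑ _a : CovIdx d₁ d₂, u * ‖v‖ :=
        Finset.sum_le_sum fun a _ => by
          rw [abs_mul]
          exact mul_le_mul (hu a) (PiLp.norm_apply_le v a) (abs_nonneg _)
            ((abs_nonneg _).trans (hu a))
    _ = _ := by
        rw [Finset.sum_const, Finset.card_univ, nsmul_eq_mul]
        simp only [Fintype.card_sum, Fintype.card_unit, Fintype.card_fin]
        push_cast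
        ring

/-- Existence and consistency of the estimator when the score is small. -/
theorem glmArgmin_near {M₂ Cd m κ u r : ℝ} {θ : Coef d₁ d₂}
    (hψ : ∀ t, HasDerivAt ψ (μ t) t) (hμ : Differentiable ℝ μ) (hμ' : Differentiable ℝ (deriv μ))
    (hpos : ∀ t, 0 < deriv μ t)
    (hM : ∀ t, |deriv (deriv μ) t| ≤ M₂) (hX : ∀ e ∈ seedPairs S, ‖X e.1 e.2‖ ≤ Cd)
    (hm : ∀ e ∈ seedPairs S, m ≤ deriv μ (inner ℝ (X e.1 e.2) θ))
    (hκ : ∀ l ∈ spectrum ℝ (glmHessian μ X S θ), κ ≤ l)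
    (hu : ∀ a, |∑ e ∈ seedPairs S, (Bt e.1 e.2 - μ (inner ℝ (X e.1 e.2) θ)) * X e.1 e.2 a| ≤ u)
    (hr : 0 < r) (hrm : M₂ * (Cd * r) ≤ m / 2) (hur : 4 * ((d₁ + d₂ + 2 : ℕ) * u) < κ * r) :
    (glmArgmin ψ X S Bt).Nonempty ∧ ∀ θ' ∈ glmArgmin ψ X S Bt, ‖θ' - θ‖ ≤ r := by
  refine exists_min_of_sphere (glmLoss_convexOn hψ
    (monotone_of_deriv_nonneg hμ fun t => (hpos t).le)) (glmLoss_continuous hψ) hr fun v hv => ?_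
  have h1 := glmLoss_lower_bound (Bt := Bt) (v := v) hψ hμ hμ' hM hX hm (by rwa [hv])
  have h2 := glmHessian_lower_bound (v := v) hκ
  have h3 := (abs_le.1 (abs_score_le hu v)).2
  rw [hv] at h2 h3
  -- On the sphere the linear term is at most d·u·r and the quadratic one at least κr²/4; `hur`
  -- makes the latter larger.
  nlinarith

end GLM

/-! ### Permutation matrices and the matching objective -/

section Permutations

variable {n : ℕ}

theorem permMatrix_apply' (σ : Equiv.Perm (Fin n)) (i j : Fin n) :
    σ.permMatrix ℝ i j = if σ i = j then 1 else 0 := by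
  simp [Equiv.Perm.permMatrix, PEquiv.toMatrix_apply, eq_comm]

theorem permMatrix_conj_apply (σ : Equiv.Perm (Fin n)) (M : Matrix (Fin n) (Fin n) ℝ)
    (i j : Fin n) :
    (σ.permMatrix ℝ * M * (σ.permMatrix ℝ).transpose) i j = M (σ i) (σ j) := by
  simp only [Matrix.mul_apply, permMatrix_apply', Matrix.transpose_apply]
  simp

theorem permMatrix_conj_transpose_apply (σ : Equiv.Perm (Fin n)) (M : Matrix (Fin n) (Fin n) ℝ)
    (i j : Fin n) :
    ((σ.permMatrix ℝ).transpose * M * σ.permMatrix ℝ) i j = M (σ⁻¹ i) (σ⁻¹ j) := by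
  have h := permMatrix_conj_apply σ⁻¹ M i j
  rwa [← Matrix.transpose_permMatrix, Matrix.transpose_transpose] at h

theorem permMatrix_mem_seededPerms {S : Finset (Fin n)} {σ : Equiv.Perm (Fin n)} :
    σ.permMatrix ℝ ∈ seededPerms S ↔ ∀ i ∈ S, σ i = i := by
  constructor
  · intro h i hi
    have := h.2 i hi i hi
    rw [permMatrix_apply', Matrix.one_apply_eq] at this
    by_contra hne
    rw [if_neg hne] at this
    exact zero_ne_one this
  · intro h
    refine ⟨⟨σ, rfl⟩, fun i hi j _ => ?_⟩
    rw [permMatrix_apply', h i hi, Matrix.one_apply]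

theorem movedNodes_permMatrix (σ : Equiv.Perm (Fin n)) :
    movedNodes (σ.permMatrix ℝ) = σ.support := by
  ext i
  simp [movedNodes]

theorem sum_sum_perm (σ : Equiv.Perm (Fin n)) (f : Fin n → Fin n → ℝ) :
    ∑ i, ∑ j, f (σ i) (σ j) = ∑ i, ∑ j, f i j := by
  rw [Equiv.sum_comp σ (fun i => ∑ j, f i (σ j))]
  exact Finset.sum_congr rfl fun i _ => Equiv.sum_comp σ (f i)

/-- The pairs `(i, j)` with `i > j`. -/
def lowerPairs (n : ℕ) : Finset (Fin n × Fin n) := Finset.univ.filter fun e => e.2 < e.1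

theorem sum_sum_eq_two_mul_lower {f : Fin n → Fin n → ℝ} (hs : ∀ i j, f i j = f j i)
    (h0 : ∀ i, f i i = 0) : ∑ i, ∑ j, f i j = 2 * ∑ e ∈ lowerPairs n, f e.1 e.2 := by
  have h1 : ∀ i j, f i j = (if j < i then f i j else 0) + (if i < j then f j i else 0) :=
    fun i j => by
      rcases lt_trichotomy i j with h | rfl | h
      · simp [h, h.not_gt, hs i j]
      · simp [h0]
      · simp [h, h.not_gt]
  have h2 : ∑ e ∈ lowerPairs n, f e.1 e.2 = ∑ i, ∑ j, (if j < i then f i j else 0) := by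
    rw [lowerPairs, Finset.sum_filter, ← Finset.univ_product_univ, Finset.sum_product]
  rw [h2, two_mul]
  nth_rewrite 3 [Finset.sum_comm]
  simp only [← Finset.sum_add_distrib]
  exact Finset.sum_congr rfl fun i _ => Finset.sum_congr rfl fun j _ => h1 i j

theorem separation_permMatrix (P : Matrix (Fin n) (Fin n) ℝ) (τ : Equiv.Perm (Fin n)) :
    separation P (τ.permMatrix ℝ) = ∑ i, ∑ j, (P i j - P (τ i) (τ j)) ^ 2 := by
  rw [separation, frobSq_eq]
  simp only [Matrix.sub_apply, permMatrix_conj_apply]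

theorem separation_permMatrix_inv (P : Matrix (Fin n) (Fin n) ℝ) (τ : Equiv.Perm (Fin n)) :
    ∑ i, ∑ j, (P (τ⁻¹ i) (τ⁻¹ j) - P i j) ^ 2 = separation P (τ.permMatrix ℝ) := by
  rw [separation_permMatrix,
    ← sum_sum_perm τ (fun i j => (P (τ⁻¹ i) (τ⁻¹ j) - P i j) ^ 2)]
  simp

theorem sum_mul_sub_perm (P : Matrix (Fin n) (Fin n) ℝ) (τ : Equiv.Perm (Fin n)) :
    ∑ i, ∑ j, P i j * (P i j - P (τ i) (τ j)) = separation P (τ.permMatrix ℝ) / 2 := by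
  have h := sum_sum_perm τ (fun i j => P i j ^ 2)
  have h1 : separation P (τ.permMatrix ℝ) = 2 * ∑ i, ∑ j, P i j * (P i j - P (τ i) (τ j)) +
      (∑ i, ∑ j, P (τ i) (τ j) ^ 2 - ∑ i, ∑ j, P i j ^ 2) := by
    rw [separation_permMatrix]
    simp only [Finset.mul_sum, ← Finset.sum_add_distrib, ← Finset.sum_sub_distrib]
    refine Finset.sum_congr rfl fun i _ => Finset.sum_congr rfl fun j _ => by ring
  rw [h] at h1
  linarith

theorem movedPairs_permMatrix_sum (τ : Equiv.Perm (Fin n)) (f : Fin n → Fin n → ℝ) :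
    ∑ e ∈ movedPairs (τ.permMatrix ℝ), f e.1 e.2 =
      ∑ e ∈ lowerPairs n, (if e.1 ∈ τ.support ∨ e.2 ∈ τ.support then f e.1 e.2 else 0) := by
  classical
  rw [← Finset.sum_filter, lowerPairs, Finset.filter_filter, movedPairs, movedNodes_permMatrix]
  refine Finset.sum_congr ?_ fun _ _ => rfl
  ext e
  simp [and_comm]

/-- The effect on the matching objective of replacing `P` by an entrywise approximation. -/
theorem abs_sum_mul_sub_perm_le {D Bm : Matrix (Fin n) (Fin n) ℝ} {ε : ℝ}
    (hBs : ∀ i j, Bm i j = Bm j i) (hB0 : ∀ i, Bm i i = 0) (hBnn : ∀ i j, 0 ≤ Bm i j)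
    (hD : ∀ i j, |D i j| ≤ ε) (τ : Equiv.Perm (Fin n)) :
    |∑ i, ∑ j, D i j * (Bm i j - Bm (τ i) (τ j))| ≤
      4 * ε * ∑ e ∈ movedPairs (τ.permMatrix ℝ), Bm e.1 e.2 := by
  -- Pairs with both labels fixed contribute nothing. The factor 4 is 2 for B and B∘τ times 2 for
  -- ordered pairs.
  let g : Fin n → Fin n → ℝ := fun i j => if i ∈ τ.support ∨ j ∈ τ.support then Bm i j else 0
  have hg : ∑ i, ∑ j, g i j = 2 * ∑ e ∈ movedPairs (τ.permMatrix ℝ), Bm e.1 e.2 := by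
    rw [movedPairs_permMatrix_sum τ (fun i j => Bm i j)]
    exact sum_sum_eq_two_mul_lower (f := g) (fun i j => by simp only [g, or_comm, hBs i j])
      (fun i => by simp [g, hB0])
  have hterm : ∀ i j, |D i j * (Bm i j - Bm (τ i) (τ j))| ≤ ε * (g i j + g (τ i) (τ j)) :=
    fun i j => by
      simp only [g, Equiv.Perm.apply_mem_support]
      rw [abs_mul]
      have hε : 0 ≤ ε := (abs_nonneg _).trans (hD i j)
      refine mul_le_mul (hD i j) ?_ (abs_nonneg _) hε
      split_ifs with h
      · have h1 := hBnn i j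
        have h2 := hBnn (τ i) (τ j)
        rw [abs_le]
        constructor <;> linarith
      · rw [not_or, Equiv.Perm.notMem_support, Equiv.Perm.notMem_support] at h
        simp [h.1, h.2]
  calc |∑ i, ∑ j, D i j * (Bm i j - Bm (τ i) (τ j))|
      ≤ ∑ i, ∑ j, |D i j * (Bm i j - Bm (τ i) (τ j))| :=
        (Finset.abs_sum_le_sum_abs _ _).trans
          (Finset.sum_le_sum fun i _ => Finset.abs_sum_le_sum_abs _ _)
    _ ≤ ∑ i, ∑ j, ε * (g i j + g (τ i) (τ j)) :=
        Finset.sum_le_sum fun i _ => Finset.sum_le_sum fun j _ => hterm i j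
    _ = ε * (∑ i, ∑ j, g i j + ∑ i, ∑ j, g (τ i) (τ j)) := by
        simp only [Finset.mul_sum, ← Finset.sum_add_distrib]
    _ = _ := by
        rw [sum_sum_perm τ g, hg]
        ring

/-- Uniqueness in the matching problem, written with permutations. -/
theorem frobSq_lt_of_noise {P Ph Bm : Matrix (Fin n) (Fin n) ℝ} {ε : ℝ}
    (hPs : ∀ i j, P i j = P j i) (hP0 : ∀ i, P i i = 0)
    (hBs : ∀ i j, Bm i j = Bm j i) (hB0 : ∀ i, Bm i i = 0) (hBnn : ∀ i j, 0 ≤ Bm i j)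
    (hPh : ∀ i j, |Ph i j - P i j| ≤ ε) (τ : Equiv.Perm (Fin n))
    (hM : 0 < separation P (τ.permMatrix ℝ))
    (hnoise : ∑ e ∈ lowerPairs n, (P (τ⁻¹ e.1) (τ⁻¹ e.2) - P e.1 e.2) * (Bm e.1 e.2 - P e.1 e.2) ≤
      separation P (τ.permMatrix ℝ) / 8)
    (hest : 4 * ε * ∑ e ∈ movedPairs (τ.permMatrix ℝ), Bm e.1 e.2 ≤
      separation P (τ.permMatrix ℝ) / 8) :
    ∑ i, ∑ j, (Ph i j - Bm i j) ^ 2 < ∑ i, ∑ j, (Ph i j - Bm (τ i) (τ j)) ^ 2 := by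
  have h1 := (abs_le.1 ((abs_sum_mul_sub_perm_le (D := Ph - P) hBs hB0 hBnn
    (fun i j => hPh i j) τ).trans hest)).1
  have h2 := sum_mul_sub_perm P τ
  have h3 := sum_sum_eq_two_mul_lower
    (f := fun i j => (P (τ⁻¹ i) (τ⁻¹ j) - P i j) * (Bm i j - P i j))
    (fun i j => by simp only [hPs i j, hBs i j, hPs (τ⁻¹ i)]) (fun i => by simp [hP0])
  have h4 : ∑ i, ∑ j, P i j * (Bm (τ i) (τ j) - P (τ i) (τ j)) =
      ∑ i, ∑ j, P (τ⁻¹ i) (τ⁻¹ j) * (Bm i j - P i j) := by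
    rw [← sum_sum_perm τ (fun i j => P (τ⁻¹ i) (τ⁻¹ j) * (Bm i j - P i j))]
    simp
  have h5 := sum_sum_perm τ (fun i j => Bm i j ^ 2)
  -- The first and last brackets vanish by reindexing. The noise over all ordered pairs is twice the
  -- lower sum, so half the gain is at least M/2 − M/8 − M/4 = M/8.
  have h6 : ∑ i, ∑ j, (Ph i j - Bm (τ i) (τ j)) ^ 2 - ∑ i, ∑ j, (Ph i j - Bm i j) ^ 2 =
      (∑ i, ∑ j, Bm (τ i) (τ j) ^ 2 - ∑ i, ∑ j, Bm i j ^ 2)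
      + 2 * (∑ i, ∑ j, P i j * (P i j - P (τ i) (τ j))
        + ∑ i, ∑ j, (Ph - P) i j * (Bm i j - Bm (τ i) (τ j))
        - ∑ i, ∑ j, (P (τ⁻¹ i) (τ⁻¹ j) - P i j) * (Bm i j - P i j)
        + (∑ i, ∑ j, P (τ⁻¹ i) (τ⁻¹ j) * (Bm i j - P i j)
          - ∑ i, ∑ j, P i j * (Bm (τ i) (τ j) - P (τ i) (τ j)))) := by
    simp only [Finset.mul_sum, ← Finset.sum_add_distrib, ← Finset.sum_sub_distrib,
      Matrix.sub_apply]
    refine Finset.sum_congr rfl fun i _ => Finset.sum_congr rfl fun j _ => by ring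
  rw [h2, h3, h4, h5] at h6
  linarith

/-- With `Qstar` given by σ, a candidate ρ compares P̂ with B relabelled by τ = σ⁻¹ρ, which again
fixes the seeds and is trivial only for ρ = σ. -/
theorem qapArgmin_eq_singleton {S : Finset (Fin n)} {Ph Bm : Matrix (Fin n) (Fin n) ℝ}
    {Qstar : Matrix (Fin n) (Fin n) ℝ} (hQ : Qstar ∈ seededPerms S)
    (h : ∀ τ : Equiv.Perm (Fin n), τ ≠ 1 → (∀ i ∈ S, τ i = i) →
      ∑ i, ∑ j, (Ph i j - Bm i j) ^ 2 < ∑ i, ∑ j, (Ph i j - Bm (τ i) (τ j)) ^ 2) :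
    qapArgmin S Ph (Qstar.transpose * Bm * Qstar) = {Qstar} := by
  obtain ⟨σ, rfl⟩ := hQ.1
  have hσ := permMatrix_mem_seededPerms.1 hQ
  have hval : ∀ ρ : Equiv.Perm (Fin n), frobSq (Ph - ρ.permMatrix ℝ *
      ((σ.permMatrix ℝ).transpose * Bm * σ.permMatrix ℝ) * (ρ.permMatrix ℝ).transpose) =
      ∑ i, ∑ j, (Ph i j - Bm ((σ⁻¹ * ρ) i) ((σ⁻¹ * ρ) j)) ^ 2 := fun ρ => by
    rw [frobSq_eq]
    simp only [Matrix.sub_apply, permMatrix_conj_apply, permMatrix_conj_transpose_apply,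
      Equiv.Perm.mul_apply]
  have hlt : ∀ ρ : Equiv.Perm (Fin n), ρ.permMatrix ℝ ∈ seededPerms S → ρ ≠ σ →
      frobSq (Ph - σ.permMatrix ℝ *
        ((σ.permMatrix ℝ).transpose * Bm * σ.permMatrix ℝ) * (σ.permMatrix ℝ).transpose) <
      frobSq (Ph - ρ.permMatrix ℝ *
        ((σ.permMatrix ℝ).transpose * Bm * σ.permMatrix ℝ) * (ρ.permMatrix ℝ).transpose) := by
    intro ρ hρ hne
    rw [hval, hval, inv_mul_cancel]
    refine h _ (fun h1 => hne (inv_mul_eq_one.1 h1).symm) fun i hi => ?_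
    rw [Equiv.Perm.mul_apply, permMatrix_mem_seededPerms.1 hρ i hi, Equiv.Perm.inv_eq_iff_eq,
      hσ i hi]
  ext Q
  rw [Set.mem_singleton_iff]
  constructor
  · rintro ⟨hQs, hmin⟩
    obtain ⟨ρ, rfl⟩ := hQs.1
    by_contra hne
    exact absurd (hmin _ hQ) (not_le.2 (hlt ρ hQs fun h1 => hne (h1 ▸ rfl)))
  · rintro rfl
    refine ⟨hQ, fun Q' hQ' => ?_⟩
    obtain ⟨ρ, rfl⟩ := hQ'.1
    by_cases hne : ρ = σ
    · rw [hne]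
    · exact (hlt ρ hQ' hne).le

end Permutations

/-! ### Probabilities of the bad events -/

section Tails

variable {n : ℕ} {Ω : Type*} [MeasurableSpace Ω] {Pr : Measure Ω} [IsProbabilityMeasure Pr]
  {P : Matrix (Fin n) (Fin n) ℝ} {B : Ω → SimpleGraph (Fin n)}

theorem IsBernoulliGraph.mem_Icc (hB : IsBernoulliGraph Pr P B) {i j : Fin n} (h : j < i) :
    P i j ∈ Set.Icc (0 : ℝ) 1 := by
  rw [← hB.prob i j h]
  exact ⟨measureReal_nonneg, measureReal_le_one⟩

theorem sum_variance_le {S : Finset (Fin n)} {L : ℝ} (hs : 2 ≤ S.card) (hL : 0 ≤ L)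
    (h : seedVariance P S ≤ L) :
    ∑ e ∈ seedPairs S, P e.1 e.2 * (1 - P e.1 e.2) ≤ L * (S.card : ℝ) ^ 2 / 2 := by
  have hs' : (2 : ℝ) ≤ S.card := by exact_mod_cast hs
  have hpos : 0 < (S.card : ℝ) * (S.card - 1) := mul_pos (by linarith) (by linarith)
  rw [seedVariance, div_mul_eq_mul_div, div_le_iff₀ hpos] at h
  nlinarith

theorem IsBernoulliGraph.score_tail (hB : IsBernoulliGraph Pr P B) {S : Finset (Fin n)}
    {L Cd : ℝ} (hs : 2 ≤ S.card) (hL : 0 < L) (hCd : 0 < Cd) (hvar : seedVariance P S ≤ L)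
    (hq : √(Real.log S.card) / (√L * S.card) ≤ 1) (x : Fin n × Fin n → ℝ)
    (hx : ∀ e ∈ seedPairs S, |x e| ≤ Cd) :
    Pr.real {ω | 2 * Cd * (S.card * (√L * √(Real.log S.card))) ≤
      ∑ e ∈ seedPairs S, (adj (B ω) e.1 e.2 - P e.1 e.2) * x e} ≤ 1 / S.card := by
  have hs' : (2 : ℝ) ≤ S.card := by exact_mod_cast hs
  have hs0 : (0 : ℝ) < S.card := by linarith
  have hlog : 0 ≤ Real.log S.card := Real.log_nonneg (by linarith)
  have hlow : ∀ e ∈ seedPairs S, e.2 < e.1 := fun e he => (Finset.mem_filter.1 he).2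
  -- Chernoff scale: it turns the threshold into 2 log s and the variance into at most (log s)/2,
  -- leaving exp(-(3/2) log s) ≤ 1/s. `hq` keeps the weights in [-1, 1].
  set q := √(Real.log S.card) / (√L * S.card) with hq_def
  have hsqL : 0 < √L := Real.sqrt_pos.2 hL
  have hq0 : 0 ≤ q := by positivity
  have hq1 : q * (S.card * (√L * √(Real.log S.card))) = Real.log S.card := by
    rw [hq_def]
    field_simp
    exact Real.sq_sqrt hlog
  have hq2 : q ^ 2 * (L * (S.card : ℝ) ^ 2) = Real.log S.card := by
    rw [hq_def, div_pow, mul_pow, Real.sq_sqrt hlog, Real.sq_sqrt hL.le]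
    field_simp
  have ht := hB.tail (seedPairs S) hlow (fun e => q * (x e / Cd)) (fun e he => by
    rw [abs_mul, abs_of_nonneg hq0, abs_div, abs_of_pos hCd]
    exact mul_le_one₀ hq (by positivity) ((div_le_one hCd).2 (hx e he))) (2 * Real.log S.card)
  refine (measureReal_mono ?_).trans (ht.trans ?_)
  · intro ω hω
    have h1 : ∑ e ∈ seedPairs S, q * (x e / Cd) * (adj (B ω) e.1 e.2 - P e.1 e.2) =
        q / Cd * ∑ e ∈ seedPairs S, (adj (B ω) e.1 e.2 - P e.1 e.2) * x e := by
      rw [Finset.mul_sum]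
      exact Finset.sum_congr rfl fun e _ => by ring
    have h2 : q / Cd * (2 * Cd * (S.card * (√L * √(Real.log S.card)))) =
        2 * Real.log S.card := by
      calc _ = 2 * (Cd / Cd) * (q * (S.card * (√L * √(Real.log S.card)))) := by ring
        _ = _ := by rw [hq1, div_self hCd.ne', mul_one]
    rw [Set.mem_ofPred_eq] at hω ⊢
    rw [h1, ← h2]
    exact mul_le_mul_of_nonneg_left hω (by positivity)
  · rw [one_div, ← Real.exp_log (inv_pos.2 hs0), Real.log_inv]
    refine Real.exp_le_exp.2 ?_
    have h3 : ∑ e ∈ seedPairs S, (q * (x e / Cd)) ^ 2 * (P e.1 e.2 * (1 - P e.1 e.2)) ≤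
        q ^ 2 * ∑ e ∈ seedPairs S, P e.1 e.2 * (1 - P e.1 e.2) := by
      rw [Finset.mul_sum]
      refine Finset.sum_le_sum fun e he => ?_
      obtain ⟨h0, h1⟩ := hB.mem_Icc (hlow e he)
      refine mul_le_mul_of_nonneg_right ?_ (mul_nonneg h0 (sub_nonneg.2 h1))
      rw [mul_pow]
      refine mul_le_of_le_one_right (sq_nonneg _) ?_
      rw [sq_le_one_iff_abs_le_one, abs_div, abs_of_pos hCd]
      exact (div_le_one hCd).2 (hx e he)
    have h4 := mul_le_mul_of_nonneg_left (sum_variance_le hs hL.le hvar) (sq_nonneg q)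
    linarith

theorem IsBernoulliGraph.abs_score_tail (hB : IsBernoulliGraph Pr P B) {S : Finset (Fin n)}
    {L Cd : ℝ} (hs : 2 ≤ S.card) (hL : 0 < L) (hCd : 0 < Cd) (hvar : seedVariance P S ≤ L)
    (hq : √(Real.log S.card) / (√L * S.card) ≤ 1) (x : Fin n × Fin n → ℝ)
    (hx : ∀ e ∈ seedPairs S, |x e| ≤ Cd) :
    Pr.real {ω | 2 * Cd * (S.card * (√L * √(Real.log S.card))) <
      |∑ e ∈ seedPairs S, (adj (B ω) e.1 e.2 - P e.1 e.2) * x e|} ≤ 2 / S.card := by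
  have h1 := hB.score_tail hs hL hCd hvar hq x hx
  have h2 := hB.score_tail hs hL hCd hvar hq (fun e => -x e) (fun e he => by
    rw [abs_neg]; exact hx e he)
  simp only [mul_neg, Finset.sum_neg_distrib] at h2
  have h3 : (2 : ℝ) / S.card = 1 / S.card + 1 / S.card := by ring
  rw [h3]
  refine (measureReal_mono ?_).trans ((measureReal_union_le _ _).trans (add_le_add h1 h2))
  intro ω hω
  rw [Set.mem_ofPred_eq] at hω
  simp only [Set.mem_union, Set.mem_ofPred_eq]
  exact (lt_abs.1 hω).imp le_of_lt le_of_lt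

/-- With weights halved, the threshold is M/16 and the variance at most (1/4)(1/4)(M/2) = M/32. -/
theorem IsBernoulliGraph.noise_tail (hB : IsBernoulliGraph Pr P B)
    (hPs : ∀ i j, P i j = P j i) (hP0 : ∀ i, P i i = 0) (τ : Equiv.Perm (Fin n)) :
    Pr.real {ω | separation P (τ.permMatrix ℝ) / 8 < ∑ e ∈ lowerPairs n,
      (P (τ⁻¹ e.1) (τ⁻¹ e.2) - P e.1 e.2) * (adj (B ω) e.1 e.2 - P e.1 e.2)} ≤
      Real.exp (-(separation P (τ.permMatrix ℝ) / 32)) := by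
  have hP01 : ∀ i j, P i j ∈ Set.Icc (0 : ℝ) 1 := fun i j => by
    rcases lt_trichotomy i j with h | rfl | h
    · rw [hPs]; exact hB.mem_Icc h
    · rw [hP0]; exact ⟨le_rfl, zero_le_one⟩
    · exact hB.mem_Icc h
  have hlow : ∀ e ∈ lowerPairs n, e.2 < e.1 := fun e he => (Finset.mem_filter.1 he).2
  have hsep : separation P (τ.permMatrix ℝ) =
      2 * ∑ e ∈ lowerPairs n, (P (τ⁻¹ e.1) (τ⁻¹ e.2) - P e.1 e.2) ^ 2 := by
    rw [← separation_permMatrix_inv]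
    exact sum_sum_eq_two_mul_lower (f := fun i j => (P (τ⁻¹ i) (τ⁻¹ j) - P i j) ^ 2)
      (fun i j => by simp only [hPs i j, hPs (τ⁻¹ i)]) (fun i => by simp [hP0])
  have ht := hB.tail (lowerPairs n) hlow
    (fun e => 1 / 2 * (P (τ⁻¹ e.1) (τ⁻¹ e.2) - P e.1 e.2)) (fun e _ => by
      have h1 := hP01 (τ⁻¹ e.1) (τ⁻¹ e.2)
      have h2 := hP01 e.1 e.2
      rw [abs_le]
      constructor <;> linarith [h1.1, h1.2, h2.1, h2.2]) (separation P (τ.permMatrix ℝ) / 16)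
  refine (measureReal_mono ?_).trans (ht.trans (Real.exp_le_exp.2 ?_))
  · intro ω hω
    rw [Set.mem_ofPred_eq] at hω ⊢
    simp only [mul_assoc, ← Finset.mul_sum]
    linarith
  · have h3 : ∑ e ∈ lowerPairs n, (1 / 2 * (P (τ⁻¹ e.1) (τ⁻¹ e.2) - P e.1 e.2)) ^ 2 *
        (P e.1 e.2 * (1 - P e.1 e.2)) ≤
        1 / 16 * ∑ e ∈ lowerPairs n, (P (τ⁻¹ e.1) (τ⁻¹ e.2) - P e.1 e.2) ^ 2 := by
      rw [Finset.mul_sum]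
      refine Finset.sum_le_sum fun e _ => ?_
      have h4 : P e.1 e.2 * (1 - P e.1 e.2) ≤ 1 / 4 := by
        nlinarith [sq_nonneg (P e.1 e.2 - 1 / 2)]
      have h5 := mul_le_mul_of_nonneg_left h4
        (sq_nonneg (1 / 2 * (P (τ⁻¹ e.1) (τ⁻¹ e.2) - P e.1 e.2)))
      linarith
    linarith

theorem mem_movedPairs_lt {Q : Matrix (Fin n) (Fin n) ℝ} {e : Fin n × Fin n}
    (he : e ∈ movedPairs Q) : e.2 < e.1 := by
  classical
  exact (Finset.mem_filter.1 he).2.2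

/-- The variance is at most the mean, so exceeding the mean by 1 + K times itself costs exp(-K ·
mean). A large K, chosen against the density constant, pays for the union over permutations. -/
theorem IsBernoulliGraph.count_tail (hB : IsBernoulliGraph Pr P B)
    (Q : Matrix (Fin n) (Fin n) ℝ) (K : ℝ) :
    Pr.real {ω | (2 + K) * ∑ e ∈ movedPairs Q, P e.1 e.2 <
      ∑ e ∈ movedPairs Q, adj (B ω) e.1 e.2} ≤
      Real.exp (-(K * ∑ e ∈ movedPairs Q, P e.1 e.2)) := by
  have ht := hB.tail (movedPairs Q) (fun e he => mem_movedPairs_lt he) (fun _ => 1)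
    (fun _ _ => by simp) ((1 + K) * ∑ e ∈ movedPairs Q, P e.1 e.2)
  refine (measureReal_mono ?_).trans (ht.trans (Real.exp_le_exp.2 ?_))
  · intro ω hω
    rw [Set.mem_ofPred_eq] at hω ⊢
    simp only [one_mul, Finset.sum_sub_distrib]
    linarith
  · have h1 : ∑ e ∈ movedPairs Q, (1 : ℝ) ^ 2 * (P e.1 e.2 * (1 - P e.1 e.2)) ≤
        ∑ e ∈ movedPairs Q, P e.1 e.2 := Finset.sum_le_sum fun e _ => by
      nlinarith [sq_nonneg (P e.1 e.2)]
    linarith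

end Tails

/-! ### Auxiliary facts for the assembly -/

theorem adj_symm {n : ℕ} (G : SimpleGraph (Fin n)) (i j : Fin n) : adj G i j = adj G j i := by
  classical
  simp [adj, SimpleGraph.adjMatrix_apply, G.adj_comm]

theorem adj_self {n : ℕ} (G : SimpleGraph (Fin n)) (i : Fin n) : adj G i i = 0 := by
  classical
  simp [adj]

theorem adj_nonneg {n : ℕ} (G : SimpleGraph (Fin n)) (i j : Fin n) : 0 ≤ adj G i j := by
  classical
  rw [adj, SimpleGraph.adjMatrix_apply]
  split_ifs <;> simp

theorem abs_probMatrix_sub_le {n d₁ d₂ : ℕ} {μ : ℝ → ℝ} {X : Fin n → Fin n → Coef d₁ d₂}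
    {θ θ' : Coef d₁ d₂} {M₁ Cd r : ℝ} (hμ : Differentiable ℝ μ) (hM : ∀ t, |deriv μ t| ≤ M₁)
    (hX : ∀ i j, i ≠ j → ‖X i j‖ ≤ Cd) (hCd : 0 ≤ Cd) (hr : ‖θ' - θ‖ ≤ r) (i j : Fin n) :
    |probMatrix μ X θ' i j - probMatrix μ X θ i j| ≤ M₁ * (Cd * r) := by
  have hM0 : 0 ≤ M₁ := (abs_nonneg _).trans (hM 0)
  have hr0 : 0 ≤ r := (norm_nonneg _).trans hr
  simp only [probMatrix, Matrix.of_apply]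
  split_ifs with h
  · simp only [sub_self, abs_zero]
    positivity
  · have h1 : ‖μ (inner ℝ (X i j) θ') - μ (inner ℝ (X i j) θ)‖ ≤
        M₁ * ‖(inner ℝ (X i j) θ' - inner ℝ (X i j) θ : ℝ)‖ :=
      Convex.norm_image_sub_le_of_norm_deriv_le (s := Set.univ) (fun x _ => hμ x)
        (fun x _ => by simpa using hM x) convex_univ trivial trivial
    rw [← inner_sub_right] at h1
    refine h1.trans (mul_le_mul_of_nonneg_left ?_ hM0)
    exact (norm_inner_le_norm _ _).trans (mul_le_mul (hX i j h) hr (norm_nonneg _) hCd)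

/-- The hidden permutation fixes the seeds, so the regression sees correctly matched edges. -/
theorem seeded_conj_apply {n : ℕ} {S : Finset (Fin n)} {Q M : Matrix (Fin n) (Fin n) ℝ}
    (hQ : Q ∈ seededPerms S) {e : Fin n × Fin n} (he : e ∈ seedPairs S) :
    (Q.transpose * M * Q) e.1 e.2 = M e.1 e.2 := by
  obtain ⟨σ, rfl⟩ := hQ.1
  have hσ := permMatrix_mem_seededPerms.1 hQ
  have he' := Finset.mem_product.1 (Finset.mem_filter.1 he).1
  rw [permMatrix_conj_transpose_apply, Equiv.Perm.inv_eq_iff_eq.2 (hσ _ he'.1).symm,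
    Equiv.Perm.inv_eq_iff_eq.2 (hσ _ he'.2).symm]

/-- Subadditivity suffices, so the success event need not be shown measurable. -/
theorem one_sub_le_measureReal {Ω : Type*} [MeasurableSpace Ω] {Pr : Measure Ω}
    [IsProbabilityMeasure Pr] {s t : Set Ω} (h : sᶜ ⊆ t) : 1 - Pr.real t ≤ Pr.real s := by
  have h1 : Pr.real Set.univ ≤ Pr.real (s ∪ t) := measureReal_mono fun ω _ => by
    by_cases hω : ω ∈ s
    · exact Or.inl hω
    · exact Or.inr (h hω)
  rw [probReal_univ] at h1
  linarith [measureReal_union_le (μ := Pr) s t]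

theorem measureReal_biUnion_perm_le {n : ℕ} (hn : 2 ≤ n) {Ω : Type*} [MeasurableSpace Ω]
    {Pr : Measure Ω} [IsProbabilityMeasure Pr] {T : Finset (Equiv.Perm (Fin n))}
    (hT : ∀ τ ∈ T, τ ≠ 1) {E : Equiv.Perm (Fin n) → Set Ω}
    (hE : ∀ τ ∈ T, Pr.real (E τ) ≤ Real.exp (-(4 * (τ.support.card * Real.log n)))) :
    Pr.real (⋃ τ ∈ T, E τ) ≤ 2 / (n : ℝ) ^ 2 :=
  calc Pr.real (⋃ τ ∈ T, E τ) ≤ ∑ τ ∈ T, Pr.real (E τ) := measureReal_biUnion_finset_le _ _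
    _ ≤ ∑ τ ∈ T, Real.exp (-(4 * (τ.support.card * Real.log n))) := Finset.sum_le_sum hE
    _ ≤ ∑ τ ∈ Finset.univ.erase (1 : Equiv.Perm (Fin n)),
          Real.exp (-(4 * (τ.support.card * Real.log n))) :=
        Finset.sum_le_sum_of_subset_of_nonneg
          (fun τ hτ => Finset.mem_erase.2 ⟨hT τ hτ, Finset.mem_univ _⟩)
          fun _ _ _ => (Real.exp_pos _).le
    _ ≤ _ := sum_perm_ne_one_exp_le hn

/-- The estimation rate `√(log s) / (√L s)` is small once `s² L` dominates `log s`. -/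
theorem rate_bounds {s L w : ℝ} (hs : 2 ≤ s) (h : (1 + w ^ 2) * Real.log s ≤ s ^ 2 * L) :
    0 < L ∧ 0 < √(Real.log s) / (√L * s) ∧ √(Real.log s) / (√L * s) ≤ 1 ∧
      w * (√(Real.log s) / (√L * s)) ≤ 1 := by
  have hlog : 0 < Real.log s := Real.log_pos (by linarith)
  have hs0 : 0 < s := by linarith
  have hL : 0 < L := by
    have h1 : 0 < s ^ 2 * L := lt_of_lt_of_le (by positivity) h
    exact pos_of_mul_pos_right h1 (by positivity)
  set q := √(Real.log s) / (√L * s) with hq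
  have hq2 : q ^ 2 * (s ^ 2 * L) = Real.log s := by
    rw [hq, div_pow, mul_pow, Real.sq_sqrt hlog.le, Real.sq_sqrt hL.le]
    field_simp
  have hq0 : 0 < q := by
    have := Real.sqrt_pos.2 hlog
    have := Real.sqrt_pos.2 hL
    positivity
  have h1 : (q ^ 2 * (1 + w ^ 2)) * Real.log s ≤ 1 * Real.log s := by
    nlinarith [mul_le_mul_of_nonneg_left h (sq_nonneg q)]
  have h2 : q ^ 2 * (1 + w ^ 2) ≤ 1 := le_of_mul_le_mul_right h1 hlog
  refine ⟨hL, hq0, ?_, ?_⟩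
  · exact (sq_le_one_iff₀ hq0.le).1 (by nlinarith [mul_nonneg (sq_nonneg q) (sq_nonneg w)])
  · exact (abs_le.1 ((sq_le_one_iff_abs_le_one _).1
      (by nlinarith [sq_nonneg q] : (w * q) ^ 2 ≤ 1))).2

end CovMatch

/-! ### Choice of constants and assembly -/

open CovMatch MeasureTheory

theorem theorem2 (d₁ d₂ : ℕ) (C Cd M₁ M₂ m c₁star : ℝ)
    (hC : 0 < C) (hCd : 0 < Cd) (hm : 0 < m) (hc₁star : 0 < c₁star) :
    ∃ c₂star c₃ c : ℝ, 0 < c₂star ∧ 0 < c₃ ∧ 0 < c ∧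
      ∀ (n : ℕ) (S : Finset (Fin n))
        -- inverse link and cumulant function
        (μ ψ : ℝ → ℝ)
        -- first graph, edge covariates, node covariates, similarity functions
        (A : SimpleGraph (Fin n)) (Y : Fin n → Fin n → Fin d₁ → ℝ)
        (Z : Fin n → Fin d₂ → ℝ) (h : Fin d₂ → ℝ → ℝ → ℝ)
        -- predictors, true coefficients, edge probabilities, true permutation, `L_s`
        (X : Fin n → Fin n → CovMatch.Coef d₁ d₂) (θstar : CovMatch.Coef d₁ d₂)
        (P Qstar : Matrix (Fin n) (Fin n) ℝ) (L : ℝ)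
        -- (conditional) probability space (given the first graph and covariates) and second graph
        (Ω : Type*) [MeasurableSpace Ω] (Pr : MeasureTheory.Measure Ω)
        [MeasureTheory.IsProbabilityMeasure Pr] (B : Ω → SimpleGraph (Fin n)),
        2 ≤ S.card →
        X = CovMatch.predictors A Y Z h →
        (∀ i j, X i j = X j i) →
        P = CovMatch.probMatrix μ X θstar →
        CovMatch.IsBernoulliGraph Pr P B →
        Qstar ∈ CovMatch.seededPerms S →
        (∀ t, HasDerivAt ψ (μ t) t) →
        -- inverse link: increasing, bounded first and second derivatives
        Differentiable ℝ μ → Differentiable ℝ (deriv μ) →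
        (∀ t, 0 < deriv μ t) → (∀ t, |deriv μ t| ≤ M₁) → (∀ t, |deriv (deriv μ) t| ≤ M₂) →
        -- `m` is a positive lower bound of `μ'` on the range of the linear predictors
        (∀ t, |t| ≤ Cd * ‖θstar‖ → m ≤ deriv μ t) →
        -- bounded predictors
        (∀ i j, j < i → ‖X i j‖ ≤ Cd) →
        -- smallest eigenvalue of the Hessian
        (∀ l ∈ spectrum ℝ (CovMatch.glmHessian μ X S θstar), C * L * (S.card : ℝ) ^ 2 ≤ l) →
        CovMatch.seedVariance P S ≤ L →
        c₃ * Real.log S.card ≤ (S.card : ℝ) ^ 2 * L →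
        -- density
        (∀ Q ∈ CovMatch.seededPerms S, 2 ≤ (CovMatch.movedNodes Q).card →
          c₁star * ((CovMatch.movedNodes Q).card * Real.log n) ≤
            ∑ e ∈ CovMatch.movedPairs Q, P e.1 e.2) →
        -- separation
        (∀ Q ∈ CovMatch.seededPerms S, 2 ≤ (CovMatch.movedNodes Q).card →
          c₂star * max ((CovMatch.movedNodes Q).card * Real.log n)
            (√(Real.log S.card) / (√L * S.card) * ∑ e ∈ CovMatch.movedPairs Q, P e.1 e.2) ≤
          CovMatch.separation P Q) →
        -- the estimate of `θstar` exists, and `Qstar` is the unique solution of the seeded QAP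
        1 - c * (1 / (n : ℝ) ^ 2 + 1 / (S.card : ℝ)) ≤
          Pr.real {ω |
            (CovMatch.glmArgmin ψ X S
              (Qstar.transpose * CovMatch.adj (B ω) * Qstar)).Nonempty ∧
            ∀ θhat ∈ CovMatch.glmArgmin ψ X S
                (Qstar.transpose * CovMatch.adj (B ω) * Qstar),
              CovMatch.qapArgmin S (CovMatch.probMatrix μ X θhat)
                (Qstar.transpose * CovMatch.adj (B ω) * Qstar) = {Qstar}} := by

  have hD : (0 : ℝ) < (d₁ + d₂ + 2 : ℕ) := by positivity
  set D : ℝ := ((d₁ + d₂ + 2 : ℕ) : ℝ) with hD_def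
  -- The radius will be Kq. The sphere criterion needs a factor above 8 = 4 · 2 (score threshold
  -- 2·Cd·…); 10 makes it strict.
  set K : ℝ := 10 * D * Cd / C with hK_def
  have hK : 0 < K := by positivity
  set w : ℝ := 2 * K * Cd * M₂ / m with hw_def
  -- In c₂*, 128 = 32 · 4 turns exp(-M/32) into n^(-4k), and the second summand absorbs the
  -- estimation error into M/8. The choice 1 + w² makes q ≤ 1 and wq ≤ 1, the latter keeping the
  -- radius inside the quadratic regime. In c, 2D counts two-sided coordinate events and 4 the two
  -- unions over permutations.
  refine ⟨128 + 32 * (|M₁| * (Cd * K)) * (2 + 4 / c₁star), 1 + w ^ 2, 2 * D + 4, by positivity,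
    by positivity, by positivity, ?_⟩
  intro n S μ ψ A Y Z h X θ P Qstar L Ω _ Pr _ B hs _ hXs hP hB hQ hψ hμ hμ' hpos hM₁ hM₂ hm' hXb
    hspec hvar hsL hdens hsep
  have hn : 2 ≤ n := hs.trans (by simpa using Finset.card_le_univ S)
  have hs' : (2 : ℝ) ≤ S.card := by exact_mod_cast hs
  have hs0 : (0 : ℝ) < S.card := by linarith
  have hlogn : 0 < Real.log n := Real.log_pos (by exact_mod_cast hn)
  -- Positivity of `L` is not assumed; it follows from the lower bound on s²L, since log s > 0.
  obtain ⟨hL, hq0, hq1, hqw⟩ := rate_bounds hs' hsL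
  set q := √(Real.log S.card) / (√L * S.card) with hq_def
  have hM₁0 : 0 ≤ M₁ := (abs_nonneg _).trans (hM₁ 0)
  rw [abs_of_nonneg hM₁0] at hsep
  have hPs : ∀ i j, P i j = P j i := fun i j => by
    simp only [hP, probMatrix, Matrix.of_apply, hXs i j, eq_comm]
  have hP0 : ∀ i, P i i = 0 := fun i => by simp [hP, probMatrix]
  have hXne : ∀ i j, i ≠ j → ‖X i j‖ ≤ Cd := fun i j hij => by
    rcases lt_or_gt_of_ne hij with h1 | h1
    · rw [hXs]; exact hXb j i h1
    · exact hXb i j h1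
  have hlow : ∀ e ∈ seedPairs S, e.2 < e.1 := fun e he => (Finset.mem_filter.1 he).2
  have hXe : ∀ e ∈ seedPairs S, ‖X e.1 e.2‖ ≤ Cd := fun e he => hXb _ _ (hlow e he)
  have hPe : ∀ e ∈ seedPairs S, P e.1 e.2 = μ (inner ℝ (X e.1 e.2) θ) := fun e he => by
    rw [hP, probMatrix, Matrix.of_apply, if_neg (hlow e he).ne']
  set T : Finset (Equiv.Perm (Fin n)) :=
    Finset.univ.filter fun τ => τ ≠ 1 ∧ ∀ i ∈ S, τ i = i with hT_def
  have hT : ∀ τ, τ ∈ T ↔ τ ≠ 1 ∧ ∀ i ∈ S, τ i = i := fun τ => by simp [hT_def]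
  have hTdens : ∀ τ ∈ T, c₁star * (τ.support.card * Real.log n) ≤
      ∑ e ∈ movedPairs (τ.permMatrix ℝ), P e.1 e.2 := fun τ hτ => by
    have h1 := hdens _ (permMatrix_mem_seededPerms.2 ((hT τ).1 hτ).2)
    rw [movedNodes_permMatrix] at h1
    exact h1 (Equiv.Perm.two_le_card_support_of_ne_one ((hT τ).1 hτ).1)
  have hTsep : ∀ τ ∈ T, (128 + 32 * (M₁ * (Cd * K)) * (2 + 4 / c₁star)) *
      max (τ.support.card * Real.log n) (q * ∑ e ∈ movedPairs (τ.permMatrix ℝ), P e.1 e.2) ≤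
      separation P (τ.permMatrix ℝ) := fun τ hτ => by
    have h1 := hsep _ (permMatrix_mem_seededPerms.2 ((hT τ).1 hτ).2)
    rw [movedNodes_permMatrix] at h1
    exact h1 (Equiv.Perm.two_le_card_support_of_ne_one ((hT τ).1 hτ).1)
  have hTk : ∀ τ ∈ T, 0 < (τ.support.card : ℝ) * Real.log n := fun τ hτ => by
    have h1 := Equiv.Perm.two_le_card_support_of_ne_one ((hT τ).1 hτ).1
    have h2 : (0 : ℝ) < τ.support.card := by exact_mod_cast (by omega : 0 < τ.support.card)
    positivity
  have hTM : ∀ τ ∈ T, 128 * (τ.support.card * Real.log n) ≤ separation P (τ.permMatrix ℝ) :=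
    fun τ hτ => by
      have h1 := le_max_left ((τ.support.card : ℝ) * Real.log n)
        (q * ∑ e ∈ movedPairs (τ.permMatrix ℝ), P e.1 e.2)
      have h2 : 0 ≤ 32 * (M₁ * (Cd * K)) * (2 + 4 / c₁star) := by positivity
      exact (mul_le_mul (by linarith) h1 (hTk τ hτ).le (by linarith)).trans (hTsep τ hτ)
  have hTest : ∀ τ ∈ T, 4 * (M₁ * (Cd * (K * q))) *
      ((2 + 4 / c₁star) * ∑ e ∈ movedPairs (τ.permMatrix ℝ), P e.1 e.2) ≤
      separation P (τ.permMatrix ℝ) / 8 := fun τ hτ => by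
    have h1 := le_max_right ((τ.support.card : ℝ) * Real.log n)
      (q * ∑ e ∈ movedPairs (τ.permMatrix ℝ), P e.1 e.2)
    have h2 : 0 ≤ 32 * (M₁ * (Cd * K)) * (2 + 4 / c₁star) := by positivity
    have h3 : 0 ≤ ∑ e ∈ movedPairs (τ.permMatrix ℝ), P e.1 e.2 :=
      (mul_nonneg hc₁star.le (hTk τ hτ).le).trans (hTdens τ hτ)
    have h4 := (mul_le_mul_of_nonneg_left h1 (add_nonneg (by norm_num : (0 : ℝ) ≤ 128) h2)).trans
      (hTsep τ hτ)
    linarith [mul_nonneg hq0.le h3]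
  set u : ℝ := 2 * Cd * (S.card * (√L * √(Real.log S.card))) with hu_def
  set r : ℝ := K * q with hr_def
  have hr : 0 < r := mul_pos hK hq0
  have hrm : M₂ * (Cd * r) ≤ m / 2 := by
    have h1 : M₂ * (Cd * r) = w * q * (m / 2) := by
      rw [hr_def, hw_def]
      field_simp
    rw [h1]
    exact mul_le_of_le_one_left (by positivity) hqw
  have hur : 4 * (D * u) < C * L * (S.card : ℝ) ^ 2 * r := by
    have hsqL : 0 < √L := Real.sqrt_pos.2 hL
    have hsqs : 0 < √(Real.log S.card) := Real.sqrt_pos.2 (Real.log_pos (by linarith))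
    have h1 : C * L * (S.card : ℝ) ^ 2 * r =
        10 * (D * Cd * (S.card * (√L * √(Real.log S.card)))) := by
      rw [hr_def, hK_def, hq_def]
      nth_rewrite 1 [← Real.mul_self_sqrt hL.le]
      field_simp
    have h2 : 0 < D * Cd * (S.card * (√L * √(Real.log S.card))) := by positivity
    rw [h1, hu_def]
    linarith
  -- Bad events: a large score coordinate, large matching noise, too many edges at moved labels.
  -- None involves the estimator, so outside them the conclusion holds for every minimizer at once.
  let E₁ : CovIdx d₁ d₂ → Set Ω := fun a =>
    {ω | u < |∑ e ∈ seedPairs S, (adj (B ω) e.1 e.2 - P e.1 e.2) * X e.1 e.2 a|}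
  let E₂ : Equiv.Perm (Fin n) → Set Ω := fun τ =>
    {ω | separation P (τ.permMatrix ℝ) / 8 < ∑ e ∈ lowerPairs n,
      (P (τ⁻¹ e.1) (τ⁻¹ e.2) - P e.1 e.2) * (adj (B ω) e.1 e.2 - P e.1 e.2)}
  let E₃ : Equiv.Perm (Fin n) → Set Ω := fun τ =>
    {ω | (2 + 4 / c₁star) * ∑ e ∈ movedPairs (τ.permMatrix ℝ), P e.1 e.2 <
      ∑ e ∈ movedPairs (τ.permMatrix ℝ), adj (B ω) e.1 e.2}
  have hE₁ : Pr.real (⋃ a ∈ Finset.univ, E₁ a) ≤ D * (2 / S.card) := by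
    refine (measureReal_biUnion_finset_le _ _).trans ?_
    refine (Finset.sum_le_sum fun a _ => hB.abs_score_tail hs hL hCd hvar hq1
      (fun e => X e.1 e.2 a) fun e he => (PiLp.norm_apply_le _ a).trans (hXe e he)).trans ?_
    rw [Finset.sum_const, nsmul_eq_mul, hD_def]
    refine le_of_eq (congrArg (fun k : ℕ => (k : ℝ) * (2 / S.card)) ?_)
    simp only [Finset.card_univ, Fintype.card_sum, Fintype.card_unit, Fintype.card_fin]
    ring
  have hE₂ : Pr.real (⋃ τ ∈ T, E₂ τ) ≤ 2 / (n : ℝ) ^ 2 :=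
    measureReal_biUnion_perm_le hn (fun τ hτ => ((hT τ).1 hτ).1) fun τ hτ =>
      (hB.noise_tail hPs hP0 τ).trans (Real.exp_le_exp.2 (by linarith [hTM τ hτ]))
  have hE₃ : Pr.real (⋃ τ ∈ T, E₃ τ) ≤ 2 / (n : ℝ) ^ 2 :=
    measureReal_biUnion_perm_le hn (fun τ hτ => ((hT τ).1 hτ).1) fun τ hτ =>
      (hB.count_tail (τ.permMatrix ℝ) (4 / c₁star)).trans (Real.exp_le_exp.2 (by
        have h1 := mul_le_mul_of_nonneg_left (hTdens τ hτ) (by positivity : 0 ≤ 4 / c₁star)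
        have h2 : 4 / c₁star * (c₁star * (τ.support.card * Real.log n)) =
            4 * (τ.support.card * Real.log n) := by field_simp
        linarith))
  have hbad : Pr.real ((⋃ a ∈ Finset.univ, E₁ a) ∪ ((⋃ τ ∈ T, E₂ τ) ∪ ⋃ τ ∈ T, E₃ τ)) ≤
      (2 * D + 4) * (1 / (n : ℝ) ^ 2 + 1 / (S.card : ℝ)) := by
    refine (measureReal_union_le _ _).trans ((add_le_add hE₁
      ((measureReal_union_le _ _).trans (add_le_add hE₂ hE₃))).trans ?_)
    have h1 : 0 ≤ D * (1 / (n : ℝ) ^ 2) := by positivity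
    have h2 : 0 ≤ 1 / (S.card : ℝ) := by positivity
    have h3 : D * (2 / S.card) = 2 * D * (1 / S.card) := by ring
    have h4 : 2 / (n : ℝ) ^ 2 = 2 * (1 / (n : ℝ) ^ 2) := by ring
    rw [h3, h4]
    linarith
  refine (sub_le_sub_left hbad 1).trans (one_sub_le_measureReal ?_)
  intro ω hω
  by_contra hgood
  refine hω ?_
  simp only [Set.mem_union, Set.mem_iUnion, not_or, not_exists, E₁, E₂, E₃, Set.mem_ofPred_eq,
    not_lt] at hgood
  obtain ⟨hg₁, hg₂, hg₃⟩ := hgood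
  have hscore : ∀ a, |∑ e ∈ seedPairs S, ((Qstar.transpose * adj (B ω) * Qstar) e.1 e.2 -
      μ (inner ℝ (X e.1 e.2) θ)) * X e.1 e.2 a| ≤ u := fun a => by
    refine (le_of_eq (congrArg _ (Finset.sum_congr rfl fun e he => ?_))).trans
      (hg₁ a (Finset.mem_univ a))
    rw [seeded_conj_apply hQ he, hPe e he]
  obtain ⟨hne, hnear⟩ := glmArgmin_near hψ hμ hμ' hpos hM₂ hXe
    (fun e he => hm' _ ((abs_real_inner_le_norm _ _).trans
      (mul_le_mul_of_nonneg_right (hXe e he) (norm_nonneg _)))) hspec hscore hr hrm hur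
  refine ⟨hne, fun θhat hθ => qapArgmin_eq_singleton hQ fun τ hτ1 hτS => ?_⟩
  have hτ := (hT τ).2 ⟨hτ1, hτS⟩
  refine frobSq_lt_of_noise hPs hP0 (adj_symm _) (adj_self _) (adj_nonneg _)
    (ε := M₁ * (Cd * r)) (fun i j => ?_) τ (by linarith [hTM τ hτ, hTk τ hτ]) (hg₂ τ hτ) ?_
  · rw [hP]
    exact abs_probMatrix_sub_le hμ hM₁ hXne hCd.le (hnear θhat hθ) i j
  · exact (mul_le_mul_of_nonneg_left (hg₃ τ hτ) (by positivity)).trans (hTest τ hτ)
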